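/- Fix a number $p\in(0,1)$, the disconnection probability. Starting from a connected graph, each edge swap disconnects the graph with probability $p$, independently of the previous swaps, and a disconnected graph is never reconnected by a further swap. Thus the graph is still connected after $T$ swaps with probability $r(T)=(1-p)^T$. If connectivity is tested only once every $T$ swaps ($T$ a non-negative integer, the speed-up window), and the $T$ swaps are cancelled when the test fails, the speed-up factor $\theta(T)=T(1-p)^T$ is the expected number of swaps actually performed between two connectivity tests; let $\theta_{\max}(p)=\sup_{T\in\mathbb{N}}\theta(T)$. The heuristics of Gkantsidis et al. changes the integer window after every connectivity test: if the graph got disconnected after the $T$ swaps then $T\leftarrow T/2$, else $T\leftarrow T+1$. Here $T/2$ is rounded, for odd $T$, to one of the two neighbouring integers by an arbitrary fixed rule. This makes the window a Markov chain $(T_t)_{t\ge 0}$ on $\mathbb{N}$ which moves from $T$ to $T+1$ with probability $(1-p)^T$ and to $T/2$ (rounded) otherwise. Theorem. For every rounding rule and every $p\in(0,1)$ the long-run average speed-up factor $$\theta_{Gkan}(p)=\lim_{n\to\infty}\frac1n\sum_{t=0}^{n-1}\mathbb{E}\left[\theta(T_t)\right]$$ of the heuristics (the expected number of swaps actually performed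 per connectivity test) exists and does not depend on the initial window $T_0\in\mathbb{N}$, and $$\forall \epsilon>0,\qquad \theta_{Gkan}(p)=o\left(\theta_{\max}(p)^{\frac12+\epsilon}\right)\quad\text{when } p\to 0^+ .$$ -/

import Mathlib

open Filter Topology Asymptotics
open scoped unitInterval

noncomputable section

namespace Gkan

/-- The outcome of one swap on a connected graph: `true` with probability `p`
(the swap disconnects the graph), `false` with probability `1 - p`. -/
def disconnects (p : I) : PMF Bool :=
  PMF.ofFintype (fun b => ((cond b (unitInterval.toNNReal p)
    (unitInterval.toNNReal (unitInterval.symm p)) : NNReal) : ENNReal)) (by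
      simp only [Fintype.sum_bool, cond_true, cond_false]
      exact_mod_cast unitInterval.toNNReal_add_toNNReal_symm p)

/-- The law of the connectivity status (`true` = connected) after `T` successive swaps from a
connected graph: each swap disconnects a connected graph with the constant probability `p`,
independently of the previous ones, and a disconnected graph is never reconnected. -/
def status (p : I) : ℕ → PMF Bool
  | 0 => PMF.pure true
  | T + 1 => (status p T).bind fun connected =>
      if connected then (disconnects p).map not else PMF.pure false

/-- The number of swaps actually performed between two connectivity tests with window `T`:
all `T` swaps are cancelled if the graph got disconnected. -/
def swapsPerformed (T : ℕ) (connected : Bool) : ℕ :=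
  if connected then T else 0

/-- The speed-up factor `θ(T)` of the window `T`: the expected number of swaps actually
performed between two connectivity tests. -/
def speedup (p : I) (T : ℕ) : ℝ :=
  ∑ c : Bool, (status p T c).toReal * (swapsPerformed T c : ℝ)

/-- The maximal speed-up factor over all windows. -/
def speedupMax (p : I) : ℝ := ⨆ T : ℕ, speedup p T

/-- `half` is the operation `T ↦ T / 2` on integer windows: exact for even `T`, and rounded
down or up (the choice may depend on `T`) for odd `T`. -/
def IsHalving (half : ℕ → ℕ) : Prop :=
  ∀ T, half T = T / 2 ∨ half T = (T + 1) / 2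

/-- The update of the window after a connectivity test. -/
def nextWindow (half : ℕ → ℕ) (T : ℕ) (connected : Bool) : ℕ :=
  if connected then T + 1 else half T

/-- The law of the window after `t` connectivity tests, starting from the window `T₀`. Every
round starts from a connected graph, since a round that disconnects the graph is cancelled. -/
def windowLaw (half : ℕ → ℕ) (p : I) (T₀ : ℕ) : ℕ → PMF ℕ
  | 0 => PMF.pure T₀
  | t + 1 => (windowLaw half p T₀ t).bind fun T => (status p T).map (nextWindow half T)

/-- The expected number of swaps actually performed in round `t` (rounds are counted from `0`).
Since the window is at most `T₀ + t` in that round, only finitely many terms are nonzero. -/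
def expectedSwaps (half : ℕ → ℕ) (p : I) (T₀ t : ℕ) : ℝ :=
  ∑' T : ℕ, (windowLaw half p T₀ t T).toReal * speedup p T

/-- The expected number of swaps actually performed per connectivity test, over the first `n`
rounds. -/
def averageSwaps (half : ℕ → ℕ) (p : I) (T₀ n : ℕ) : ℝ :=
  (∑ t ∈ Finset.range n, expectedSwaps half p T₀ t) / n

/-- `θ` is the speed-up factor of the heuristics for the disconnection probability `p`: the
long-run expected number of swaps actually performed between two connectivity tests, whatever
the initial window. -/
def IsSpeedupFactor (half : ℕ → ℕ) (p : I) (θ : ℝ) : Prop :=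
  ∀ T₀ : ℕ, Tendsto (averageSwaps half p T₀) atTop (𝓝 θ)

end Gkan

end

/-! Balance of drifts. At window `T` the chain gains at most 1, while a failed test, of probability
about `pT` for small `pT`, costs about `T / 2`. Equilibrium sits near `pT² ≈ 1`, so the heuristics
earns only `O(1/√p)` swaps per test, whereas a window of order `1/p` earns order `1/p`.

Existence of the average goes through the Poisson equation `f = c + h - P h` with `P` the transition
operator (`exists_poisson_solution`). Along the chain it telescopes, leaving `c` plus a boundary
term over `n`. This term vanishes because `h` grows at most linearly (`exists_lyapunov`) and the
mean window stays bounded (`windowMean_id_le`). The same telescoping, applied to the inequality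
`speedup_le_drift` with `T/√p` in place of `h`, gives the bound `3/√p` without any invariant law. -/

namespace Gkan

/-! ### The transition operator of the window chain -/

/-- The transition operator of the window chain, acting on functions of the window, where `q` is
the probability that a swap keeps the graph connected. -/
def step (half : ℕ → ℕ) (q : ℝ) (f : ℕ → ℝ) (T : ℕ) : ℝ :=
  q ^ T * f (T + 1) + (1 - q ^ T) * f (half T)

/-- The transition operator of the window chain killed when it enters the window `1`. -/
def killedStep (half : ℕ → ℕ) (q : ℝ) (f : ℕ → ℝ) : ℕ → ℝ :=
  step half q (Function.update f 1 0)

theorem IsHalving.le {half : ℕ → ℕ} (h : IsHalving half) (T : ℕ) : half T ≤ T := by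
  rcases h T with h | h <;> omega

theorem IsHalving.cast_le {half : ℕ → ℕ} (h : IsHalving half) (T : ℕ) :
    (half T : ℝ) ≤ (T + 1) / 2 := by
  have : 2 * half T ≤ T + 1 := by rcases h T with h | h <;> omega
  have : (2 : ℝ) * half T ≤ T + 1 := by exact_mod_cast this
  linarith

section Operator

variable {half : ℕ → ℕ} {q : ℝ}

theorem step_mono (h0 : 0 ≤ q) (h1 : q ≤ 1) {f g : ℕ → ℝ} (hfg : ∀ T, f T ≤ g T) (T : ℕ) :
    step half q f T ≤ step half q g T := by
  have a : 0 ≤ q ^ T := pow_nonneg h0 T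
  have b : 0 ≤ 1 - q ^ T := sub_nonneg.2 (pow_le_one₀ h0 h1)
  exact add_le_add (mul_le_mul_of_nonneg_left (hfg _) a) (mul_le_mul_of_nonneg_left (hfg _) b)

theorem killedStep_mono (h0 : 0 ≤ q) (h1 : q ≤ 1) {f g : ℕ → ℝ} (hfg : ∀ T, f T ≤ g T) (T : ℕ) :
    killedStep half q f T ≤ killedStep half q g T := by
  refine step_mono h0 h1 (fun S => ?_) T
  by_cases hS : S = 1 <;> simp [hS, hfg S]

theorem killedStep_smul (c : ℝ) (f : ℕ → ℝ) (T : ℕ) :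
    killedStep half q (fun S => c * f S) T = c * killedStep half q f T := by
  simp only [killedStep, step, Function.update_apply]
  split_ifs <;> ring

/-! ### Poisson equation by cutting the chain at visits to window 1 -/

/-- Under a Lyapunov function `V` for the killed chain, the equation `g = f + Q g` has a solution
for every bounded nonnegative `f`. -/
theorem exists_killed_potential (h0 : 0 ≤ q) (h1 : q ≤ 1) {V : ℕ → ℝ} (hV0 : ∀ T, 0 ≤ V T)
    (hV : ∀ T, 1 + killedStep half q V T ≤ V T) {f : ℕ → ℝ} {K : ℝ} (hf : ∀ T, 0 ≤ f T)
    (hfK : ∀ T, f T ≤ K) :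
    ∃ g : ℕ → ℝ, (∀ T, 0 ≤ g T) ∧ (∀ T, g T ≤ K * V T) ∧
      ∀ T, g T = f T + killedStep half q g T := by
  have hK : 0 ≤ K := (hf 0).trans (hfK 0)
  -- Partial sums of the expected total of `f` up to the entrance into window 1; they increase and
  -- stay below `K * V`.
  let S : ℕ → ℕ → ℝ := fun n => (fun g T => f T + killedStep half q g T)^[n] fun _ => 0
  have hS : ∀ n T, S (n + 1) T = f T + killedStep half q (S n) T := fun n T => by
    simp only [S, Function.iterate_succ_apply']
  have hle : ∀ n T, S n T ≤ K * V T := by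
    intro n
    induction n with
    | zero => exact fun T => mul_nonneg hK (hV0 T)
    | succ n ih =>
      intro T
      rw [hS]
      have := killedStep_mono (half := half) h0 h1 ih T
      rw [killedStep_smul] at this
      nlinarith [hfK T, hV T]
  have hstep : ∀ n T, S n T ≤ S (n + 1) T := by
    intro n
    induction n with
    | zero =>
      intro T
      have hz : S 0 = fun _ => 0 := rfl
      have : killedStep half q (S 0) T = 0 := by
        simp [killedStep, step, hz, Function.update_apply]
      rw [hS, this, add_zero]
      exact hf T
    | succ n ih =>
      intro T
      rw [hS (n + 1), hS n]
      exact add_le_add_right (killedStep_mono h0 h1 ih T) _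
  have hmono : ∀ T, Monotone fun n => S n T := fun T => monotone_nat_of_le_succ fun n => hstep n T
  have hbdd : ∀ T, BddAbove (Set.range fun n => S n T) := fun T =>
    ⟨K * V T, by rintro _ ⟨n, rfl⟩; exact hle n T⟩
  have hlim : ∀ T, Tendsto (fun n => S n T) atTop (𝓝 (⨆ n, S n T)) := fun T =>
    tendsto_atTop_ciSup (hmono T) (hbdd T)
  refine ⟨fun T => ⨆ n, S n T, fun T => (le_ciSup (hbdd T) 0 : _), fun T => ciSup_le fun n => hle n T,
    fun T => ?_⟩
  have hu : ∀ T, Tendsto (fun n => Function.update (S n) 1 0 T) atTop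
      (𝓝 (Function.update (fun T => ⨆ n, S n T) 1 0 T)) := by
    intro T
    by_cases hT : T = 1
    · subst hT; simp
    · simpa [Function.update_apply, hT] using hlim T
  have hQ : Tendsto (fun n => S (n + 1) T) atTop
      (𝓝 (f T + killedStep half q (fun T => ⨆ n, S n T) T)) := by
    simp only [hS, killedStep, step]
    exact (((hu _).const_mul _).add ((hu _).const_mul _)).const_add _
  exact tendsto_nhds_unique ((tendsto_add_atTop_iff_nat 1).2 (hlim T)) hQ

/-- The Poisson equation of the window chain, given a Lyapunov function for the killed chain. -/
theorem exists_poisson_solution (h0 : 0 ≤ q) (h1 : q ≤ 1) {V : ℕ → ℝ} (hV0 : ∀ T, 0 ≤ V T)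
    (hV : ∀ T, 1 + killedStep half q V T ≤ V T) {f : ℕ → ℝ} {K : ℝ} (hf : ∀ T, 0 ≤ f T)
    (hfK : ∀ T, f T ≤ K) :
    ∃ (c L : ℝ) (h : ℕ → ℝ), (∀ T, |h T| ≤ L * V T) ∧
      ∀ T, f T = c + (h T - step half q h T) := by
  obtain ⟨g, hg0, hgV, hg⟩ := exists_killed_potential h0 h1 hV0 hV hf hfK
  obtain ⟨u, hu0, huV, hu⟩ := exists_killed_potential h0 h1 hV0 hV (f := fun _ => 1) (K := 1)
    (fun _ => zero_le_one) (fun _ => le_rfl)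
  have hu1 : 1 ≤ u 1 := by
    rw [hu 1]
    have := killedStep_mono (half := half) h0 h1 hu0 1
    have hz : killedStep half q (fun _ => 0) 1 = 0 := by
      simp [killedStep, step, Function.update_apply]
    linarith
  -- Expected reward of a cycle over its expected length. This choice makes `g - c * u` vanish at 1,
  -- so killing there does not affect it.
  set c := g 1 / u 1 with hc
  have hc0 : 0 ≤ c := div_nonneg (hg0 1) (hu0 1)
  have hh1 : g 1 - c * u 1 = 0 := by rw [hc]; field_simp; ring
  refine ⟨c, K + c, fun T => g T - c * u T, fun T => ?_, fun T => ?_⟩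
  · rw [abs_le]
    have := mul_le_mul_of_nonneg_left (huV T) hc0
    have := mul_nonneg hc0 (hu0 T)
    have := hg0 T
    have := hgV T
    constructor <;> nlinarith
  · have hkill : step half q (fun T => g T - c * u T) T
        = killedStep half q g T - c * killedStep half q u T := by
      have hupd : (fun T => g T - c * u T)
          = fun T => Function.update g 1 0 T - c * Function.update u 1 0 T := by
        funext S
        by_cases hS : S = 1
        · subst hS; simpa using hh1
        · simp [hS]
      rw [hupd]
      simp only [killedStep, step]
      ring
    rw [hkill]
    linear_combination c * hu T - hg T

/-! ### Drift estimates and the Lyapunov function -/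

/-- Bernoulli for `1 + p`, then `(1 - p)(1 + p) ≤ 1`. It bounds the failure probability below by
`pT(1 - p)^T`. -/
theorem pow_mul_one_add_le_one {p : ℝ} (h0 : 0 ≤ p) (h1 : p ≤ 1) (T : ℕ) :
    (1 - p) ^ T * (1 + p * T) ≤ 1 := by
  have hB : 1 + p * T ≤ (1 + p) ^ T := by
    have := one_add_mul_le_pow (a := p) (by linarith) T
    linarith
  calc (1 - p) ^ T * (1 + p * T) ≤ (1 - p) ^ T * (1 + p) ^ T :=
        mul_le_mul_of_nonneg_left hB (pow_nonneg (by linarith) T)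
    _ = (1 - p ^ 2) ^ T := by rw [← mul_pow]; ring
    _ ≤ 1 := pow_le_one₀ (by nlinarith) (by nlinarith)

theorem pow_mul_le_inv {p : ℝ} (h0 : 0 < p) (h1 : p ≤ 1) (T : ℕ) : (1 - p) ^ T * T ≤ 1 / p := by
  rw [le_div_iff₀ h0]
  nlinarith [pow_mul_one_add_le_one h0.le h1 T, pow_nonneg (sub_nonneg.2 h1) T]

/-- The bounded part of the Lyapunov function decreases on average, by an amount that
is positive on every bounded range of windows. -/
theorem step_geometric_le (hhalf : IsHalving half) {p s : ℝ} (h0 : 0 < p) (h1 : p ≤ 1)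
    (hs : s = p / 2) {T : ℕ} (hT : 2 ≤ T) :
    step half (1 - p) (fun S => -s ^ S) T ≤ -s ^ T - p / 4 * s ^ (T - 1) := by
  have hs0 : 0 < s := by linarith
  have hq0 : 0 ≤ (1 - p) ^ T := pow_nonneg (by linarith) T
  have hq1 : (1 - p) ^ T ≤ 1 - p := pow_le_of_le_one (by linarith) (by linarith) (by omega)
  have hle : s ^ (T - 1) ≤ s ^ half T := by
    refine pow_le_pow_of_le_one hs0.le (by linarith) ?_
    rcases hhalf T with h | h <;> omega
  obtain ⟨n, rfl⟩ : ∃ n, T = n + 1 := ⟨T - 1, by omega⟩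
  simp only [step, Nat.add_sub_cancel] at *
  set y := (1 - p) ^ (n + 1)
  have hsn : 0 < s ^ n := pow_pos hs0 n
  have h2 : (1 - y) * s ^ n ≤ (1 - y) * s ^ half (n + 1) :=
    mul_le_mul_of_nonneg_left hle (by linarith)
  have e1 : s ^ (n + 1) = s * s ^ n := by ring
  have e2 : s ^ (n + 1 + 1) = s * s * s ^ n := by ring
  rw [e1, e2]
  have key : s - y * (s * s) - (1 - y) + p / 4 ≤ 0 := by
    subst hs
    nlinarith
  nlinarith [mul_nonneg hsn.le (neg_nonneg.2 key)]

theorem step_id_le (hhalf : IsHalving half) {p : ℝ} (h0 : 0 ≤ p) (h1 : p ≤ 1) (T : ℕ) :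
    step half (1 - p) (fun S => (S : ℝ)) T
      ≤ T + (1 - p) ^ T - (1 - (1 - p) ^ T) * ((T - 1) / 2) := by
  have hq1 : (1 - p) ^ T ≤ 1 := pow_le_one₀ (by linarith) (by linarith)
  have := mul_le_mul_of_nonneg_left (hhalf.cast_le T) (sub_nonneg.2 hq1)
  simp only [step]
  push_cast
  linarith

/-- Large windows drift down linearly; on the remaining windows `T ≥ 2` a large multiple of the
bounded term `1 - s ^ T` supplies the decrease. Windows 0 and 1 are treated by hand. Window 1 is the
killing state because it is revisited under every rounding rule, whereas 0 may be unreachable from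
it. -/
theorem exists_lyapunov (hhalf : IsHalving half) {p : ℝ} (h0 : 0 < p) (h1 : p ≤ 1) :
    ∃ (V : ℕ → ℝ) (D : ℝ), (∀ T, 0 ≤ V T) ∧ (∀ T, V T ≤ D * (T + 1)) ∧
      ∀ T, 1 + killedStep half (1 - p) V T ≤ V T := by
  obtain ⟨s, hs⟩ : ∃ s, s = p / 2 := ⟨_, rfl⟩
  have hs0 : 0 < s := by linarith
  have hs1 : s ≤ 1 := by linarith
  -- Beyond `N` the loss `p(T - 1)/2` is at least 2, covering the possible gain 1 and the required
  -- decrease 1. Below `N`, `A` makes the geometric term lose at least 2.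
  obtain ⟨N, hN⟩ := exists_nat_ge (4 / p + 1)
  have hsN : 0 < s ^ N := pow_pos hs0 N
  obtain ⟨A, hA⟩ : ∃ A, A = 8 / (p * s ^ N) := ⟨_, rfl⟩
  have hA0 : 0 < A := by rw [hA]; positivity
  let W : ℕ → ℝ := fun T => 1 + T + A * (1 - s ^ T)
  have hW0 : ∀ T, 1 ≤ W T := fun T => by
    have : 0 ≤ A * (1 - s ^ T) := mul_nonneg hA0.le (sub_nonneg.2 (pow_le_one₀ hs0.le hs1))
    have : (0 : ℝ) ≤ T := T.cast_nonneg
    simp only [W]; linarith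
  have hWA : ∀ T, W T ≤ (1 + A) * (T + 1) := fun T => by
    have : 0 < s ^ T := pow_pos hs0 T
    have : (0 : ℝ) ≤ T := T.cast_nonneg
    simp only [W]; nlinarith [mul_pos hA0 ‹0 < s ^ T›, mul_nonneg hA0.le this]
  have hWstep : ∀ T, 2 ≤ T → 1 + step half (1 - p) W T ≤ W T := by
    intro T hT
    have e : step half (1 - p) W T = 1 + A + step half (1 - p) (fun S => (S : ℝ)) T
        + A * step half (1 - p) (fun S => -s ^ S) T := by
      simp only [step, W]; ring
    have g1 := step_geometric_le hhalf h0 h1 hs hT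
    have g2 := step_id_le hhalf h0.le h1 T
    have g3 := mul_le_mul_of_nonneg_left g1 hA0.le
    have hq0 : 0 ≤ (1 - p) ^ T := pow_nonneg (by linarith) T
    have hq1 : (1 - p) ^ T ≤ 1 - p := pow_le_of_le_one (by linarith) (by linarith) (by omega)
    have hT' : (2 : ℝ) ≤ T := by exact_mod_cast hT
    have hpos : 0 < A * (p / 4 * s ^ (T - 1)) := by positivity
    have g4 : (1 - p) ^ T - (1 - (1 - p) ^ T) * ((T - 1) / 2) ≤ 1 - p * ((T - 1) / 2) := by
      have : p * (((T : ℝ) - 1) / 2) ≤ (1 - (1 - p) ^ T) * ((T - 1) / 2) :=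
        mul_le_mul_of_nonneg_right (by linarith) (by linarith)
      linarith
    have g5 : 1 + (1 - p * (((T : ℝ) - 1) / 2)) ≤ A * (p / 4 * s ^ (T - 1)) := by
      rcases le_total N T with h | h
      · have h' : (N : ℝ) ≤ T := by exact_mod_cast h
        have : 4 / p ≤ T - 1 := by linarith
        rw [div_le_iff₀ h0] at this
        linarith
      · have hle : s ^ N ≤ s ^ (T - 1) := pow_le_pow_of_le_one hs0.le hs1 (by omega)
        have e2 : A * (p / 4 * s ^ N) = 2 := by
          rw [hA]; field_simp; norm_num
        have : A * (p / 4 * s ^ N) ≤ A * (p / 4 * s ^ (T - 1)) := by gcongr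
        have : 0 ≤ p * (((T : ℝ) - 1) / 2) := mul_nonneg h0.le (by linarith)
        linarith
    rw [e]
    simp only [W]
    linarith
  have hkill : ∀ T, killedStep half (1 - p) (Function.update W 1 (1 + W 0 + W 2)) T
      = killedStep half (1 - p) W T := fun T => by
    simp only [killedStep, Function.update_idem]
  -- The killed operator never reads the value at 1, so it can be raised to dominate both possible
  -- moves out of window 1.
  refine ⟨Function.update W 1 (1 + W 0 + W 2), 5 * (1 + A), fun T => ?_, fun T => ?_, fun T => ?_⟩
  · by_cases hT : T = 1
    · subst hT; simp only [Function.update_self]; linarith [hW0 0, hW0 2]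
    · rw [Function.update_of_ne hT]; linarith [hW0 T]
  · by_cases hT : T = 1
    · subst hT
      have a := hWA 0
      have b := hWA 2
      simp only [Function.update_self]
      push_cast at a b ⊢
      linarith
    · rw [Function.update_of_ne hT]
      have : (0 : ℝ) ≤ T := T.cast_nonneg
      nlinarith [hWA T, mul_nonneg hA0.le this]
  · rw [hkill]
    rcases (by omega : T = 0 ∨ T = 1 ∨ 2 ≤ T) with rfl | rfl | hT
    · have : killedStep half (1 - p) W 0 = 0 := by simp [killedStep, step]
      rw [this, Function.update_of_ne (by norm_num)]
      linarith [hW0 0]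
    · have h2 : Function.update W 1 0 2 = W 2 := Function.update_of_ne (by norm_num) _ _
      have h3 : Function.update W 1 0 (half 1) ≤ W 0 := by
        rcases (by have := hhalf.le 1; omega : half 1 = 0 ∨ half 1 = 1) with h | h
        · rw [h, Function.update_of_ne (by norm_num)]
        · rw [h, Function.update_self]; linarith [hW0 0]
      simp only [killedStep, step, Function.update_self, pow_one, Nat.reduceAdd, h2]
      nlinarith [hW0 0, hW0 2]
    · rw [Function.update_of_ne (by omega)]
      refine le_trans (add_le_add_right (step_mono (by linarith) (by linarith) (fun S => ?_) T) 1)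
        (hWstep T hT)
      by_cases hS : S = 1
      · subst hS; simp only [Function.update_self]; linarith [hW0 1]
      · rw [Function.update_of_ne hS]

end Operator

/-! ### The law of the window -/

theorem toReal_status_true (p : I) (T : ℕ) : (status p T true).toReal = (1 - (p : ℝ)) ^ T := by
  induction T with
  | zero => simp [status]
  | succ T ih =>
    have : status p (T + 1) true
        = status p T true * ((unitInterval.toNNReal (unitInterval.symm p) : NNReal) : ENNReal) := by
      have hmap : (disconnects p).map not true
          = ((unitInterval.toNNReal (unitInterval.symm p) : NNReal) : ENNReal) := by
        rw [PMF.map_apply, tsum_bool]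
        simp [disconnects]
      rw [status, PMF.bind_apply, tsum_bool, if_pos rfl, hmap]
      simp
    rw [this, ENNReal.toReal_mul, ih, pow_succ]
    simp

theorem toReal_status_false (p : I) (T : ℕ) :
    (status p T false).toReal = 1 - (1 - (p : ℝ)) ^ T := by
  have h := (status p T).tsum_coe
  rw [tsum_bool] at h
  have := congrArg ENNReal.toReal h
  rw [ENNReal.toReal_add ((status p T).apply_ne_top _) ((status p T).apply_ne_top _),
    toReal_status_true] at this
  simp only [ENNReal.toReal_one] at this
  linarith

theorem speedup_eq (p : I) (T : ℕ) : speedup p T = (1 - (p : ℝ)) ^ T * T := by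
  simp [speedup, swapsPerformed, toReal_status_true]

/-- The expectation of a function of the window after `t` connectivity tests. -/
noncomputable def windowMean (half : ℕ → ℕ) (p : I) (T₀ t : ℕ) (f : ℕ → ℝ) : ℝ :=
  ∑' T : ℕ, (windowLaw half p T₀ t T).toReal * f T

section Law

variable {half : ℕ → ℕ} (hhalf : IsHalving half) (p : I) (T₀ : ℕ)

theorem map_nextWindow_apply (T T' : ℕ) :
    (((status p T).map (nextWindow half T)) T').toReal
      = (if T' = T + 1 then (1 - (p : ℝ)) ^ T else 0)
        + (if T' = half T then 1 - (1 - (p : ℝ)) ^ T else 0) := by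
  rw [PMF.map_apply, tsum_bool, ENNReal.toReal_add (by split_ifs <;> simp [PMF.apply_ne_top])
    (by split_ifs <;> simp [PMF.apply_ne_top]), add_comm]
  simp only [nextWindow, if_true, Bool.false_eq_true, if_false, apply_ite ENNReal.toReal,
    toReal_status_true, toReal_status_false, ENNReal.toReal_zero]

include hhalf in
theorem windowLaw_eq_zero (t : ℕ) {T : ℕ} (hT : T₀ + t < T) : windowLaw half p T₀ t T = 0 := by
  induction t generalizing T with
  | zero => simp only [windowLaw, PMF.pure_apply]; rw [if_neg (by omega)]
  | succ t ih =>
    rw [windowLaw, PMF.bind_apply, ENNReal.tsum_eq_zero]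
    intro S
    rcases lt_or_ge (T₀ + t) S with h | h
    · rw [ih h, zero_mul]
    · have hS := hhalf.le S
      have : ((status p S).map (nextWindow half S)) T = 0 := by
        rw [PMF.map_apply, tsum_bool]
        simp only [nextWindow, if_true, Bool.false_eq_true, if_false]
        rw [if_neg (by omega), if_neg (by omega), add_zero]
      rw [this, mul_zero]

include hhalf in
theorem windowMean_eq_sum (t : ℕ) (f : ℕ → ℝ) {n : ℕ} (hn : T₀ + t < n) :
    windowMean half p T₀ t f
      = ∑ T ∈ Finset.range n, (windowLaw half p T₀ t T).toReal * f T := by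
  refine tsum_eq_sum fun T hT => ?_
  rw [windowLaw_eq_zero hhalf p T₀ t (by simp at hT; omega)]
  simp

theorem windowMean_zero (f : ℕ → ℝ) : windowMean half p T₀ 0 f = f T₀ := by
  rw [windowMean, tsum_eq_single T₀ fun T hT => by simp [windowLaw, hT]]
  simp [windowLaw]

include hhalf in
theorem windowMean_succ (t : ℕ) (f : ℕ → ℝ) :
    windowMean half p T₀ (t + 1) f = windowMean half p T₀ t (step half (1 - (p : ℝ)) f) := by
  have hlaw : ∀ T', (windowLaw half p T₀ (t + 1) T').toReal
      = ∑ T ∈ Finset.range (T₀ + t + 1), (windowLaw half p T₀ t T).toReal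
        * (((status p T).map (nextWindow half T)) T').toReal := by
    intro T'
    rw [windowLaw, PMF.bind_apply, tsum_eq_sum (s := Finset.range (T₀ + t + 1)) fun T hT => by
      rw [windowLaw_eq_zero hhalf p T₀ t (by simp at hT; omega), zero_mul],
      ENNReal.toReal_sum fun T _ => ENNReal.mul_ne_top (PMF.apply_ne_top _ _) (PMF.apply_ne_top _ _)]
    simp only [ENNReal.toReal_mul]
  rw [windowMean_eq_sum hhalf p T₀ (t + 1) f (n := T₀ + t + 2) (by omega),
    windowMean_eq_sum hhalf p T₀ t _ (n := T₀ + t + 1) (by omega)]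
  simp only [hlaw, Finset.sum_mul]
  rw [Finset.sum_comm]
  refine Finset.sum_congr rfl fun T hT => ?_
  have hT1 : T + 1 ∈ Finset.range (T₀ + t + 2) := by simp at hT ⊢; omega
  have hT2 : half T ∈ Finset.range (T₀ + t + 2) := by
    have := hhalf.le T
    simp at hT ⊢; omega
  simp only [mul_assoc, ← Finset.mul_sum, map_nextWindow_apply, add_mul, ite_mul, zero_mul,
    Finset.sum_add_distrib, Finset.sum_ite_eq', hT1, hT2, if_true, step]

include hhalf in
theorem windowMean_mono (t : ℕ) {f g : ℕ → ℝ} (hfg : ∀ T, f T ≤ g T) :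
    windowMean half p T₀ t f ≤ windowMean half p T₀ t g := by
  rw [windowMean_eq_sum hhalf p T₀ t f (Nat.lt_succ_self _),
    windowMean_eq_sum hhalf p T₀ t g (Nat.lt_succ_self _)]
  exact Finset.sum_le_sum fun T _ => mul_le_mul_of_nonneg_left (hfg T) ENNReal.toReal_nonneg

include hhalf in
theorem windowMean_add (t : ℕ) (f g : ℕ → ℝ) :
    windowMean half p T₀ t (fun T => f T + g T)
      = windowMean half p T₀ t f + windowMean half p T₀ t g := by
  simp only [windowMean_eq_sum hhalf p T₀ t _ (Nat.lt_succ_self _), mul_add,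
    Finset.sum_add_distrib]

include hhalf in
theorem windowMean_const_mul (t : ℕ) (c : ℝ) (f : ℕ → ℝ) :
    windowMean half p T₀ t (fun T => c * f T) = c * windowMean half p T₀ t f := by
  simp only [windowMean_eq_sum hhalf p T₀ t _ (Nat.lt_succ_self _), Finset.mul_sum]
  exact Finset.sum_congr rfl fun T _ => by ring

include hhalf in
theorem windowMean_const (t : ℕ) (c : ℝ) : windowMean half p T₀ t (fun _ => c) = c := by
  induction t with
  | zero => exact windowMean_zero p T₀ _
  | succ t ih =>
    rw [windowMean_succ hhalf]
    have : step half (1 - (p : ℝ)) (fun _ => c) = fun _ => c := by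
      funext T; simp only [step]; ring
    rw [this, ih]

include hhalf in
/-- Summation of the Poisson equation along the chain. -/
theorem sum_windowMean_sub_step (h : ℕ → ℝ) (c : ℝ) (n : ℕ) :
    ∑ t ∈ Finset.range n, windowMean half p T₀ t
        (fun T => c + (h T - step half (1 - (p : ℝ)) h T))
      = n * c + (h T₀ - windowMean half p T₀ n h) := by
  have key : ∀ t, windowMean half p T₀ t (fun T => c + (h T - step half (1 - (p : ℝ)) h T))
      = c + (windowMean half p T₀ t h - windowMean half p T₀ (t + 1) h) := fun t => by
    have := windowMean_add hhalf p T₀ t (fun T => h T - step half (1 - (p : ℝ)) h T)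
      (step half (1 - (p : ℝ)) h)
    simp only [sub_add_cancel] at this
    rw [windowMean_add hhalf, windowMean_const hhalf, windowMean_succ hhalf, this]
    ring
  simp only [key, Finset.sum_add_distrib, Finset.sum_range_sub', Finset.sum_const,
    Finset.card_range, nsmul_eq_mul, windowMean_zero]

-- One step maps the mean `m` to at most `m / 2 + 1 + 1/(2p)`, an affine contraction with fixed
-- point `2 + 1/p`.
include hhalf in
theorem windowMean_id_le (hp : 0 < p) (t : ℕ) :
    windowMean half p T₀ t (fun T => (T : ℝ)) ≤ T₀ + (2 + 1 / (p : ℝ)) := by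
  have h0 : 0 < (p : ℝ) := hp
  have hinv : 0 < 1 / (p : ℝ) := by positivity
  induction t with
  | zero => rw [windowMean_zero]; linarith
  | succ t ih =>
    have hstep : ∀ T : ℕ, step half (1 - (p : ℝ)) (fun S => (S : ℝ)) T
        ≤ (1 / 2) * T + (1 + 1 / (p : ℝ) / 2) := fun T => by
      have a := step_id_le hhalf h0.le p.2.2 T
      have b := pow_mul_le_inv h0 p.2.2 T
      have c : (1 - (p : ℝ)) ^ T ≤ 1 := pow_le_one₀ (by linarith [p.2.2]) (by linarith)
      linarith
    rw [windowMean_succ hhalf]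
    refine (windowMean_mono hhalf p T₀ t hstep).trans ?_
    rw [windowMean_add hhalf, windowMean_const hhalf, windowMean_const_mul hhalf]
    have : (0 : ℝ) ≤ T₀ := T₀.cast_nonneg
    linarith

end Law

/-! ### The long-run average -/

theorem exists_isSpeedupFactor {half : ℕ → ℕ} (hhalf : IsHalving half) {p : I} (hp : 0 < p) :
    ∃ θ, IsSpeedupFactor half p θ := by
  have h0 : 0 < (p : ℝ) := hp
  have h1 : (p : ℝ) ≤ 1 := p.2.2
  obtain ⟨V, D, hV0, hVD, hV⟩ := exists_lyapunov hhalf h0 h1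
  obtain ⟨c, L, h, hL, hc⟩ := exists_poisson_solution (f := speedup p) (K := 1 / (p : ℝ))
    (sub_nonneg.2 h1) (by linarith) hV0 hV
    (fun T => by rw [speedup_eq]; exact mul_nonneg (pow_nonneg (sub_nonneg.2 h1) T) T.cast_nonneg)
    (fun T => by rw [speedup_eq]; exact pow_mul_le_inv h0 h1 T)
  refine ⟨c, fun T₀ => ?_⟩
  set M := |L| * |D| * (T₀ + (2 + 1 / (p : ℝ)) + 1) with hM
  have habs : ∀ T, |h T| ≤ |L| * |D| * ((T : ℝ) + 1) := fun T => by
    have hT : (0 : ℝ) ≤ (T : ℝ) + 1 := by positivity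
    calc |h T| ≤ L * V T := hL T
      _ ≤ |L| * V T := mul_le_mul_of_nonneg_right (le_abs_self L) (hV0 T)
      _ ≤ |L| * (|D| * (T + 1)) := mul_le_mul_of_nonneg_left
          ((hVD T).trans (mul_le_mul_of_nonneg_right (le_abs_self D) hT)) (abs_nonneg L)
      _ = _ := by ring
  have hlin : ∀ n, windowMean half p T₀ n (fun T => |L| * |D| * ((T : ℝ) + 1)) ≤ M := fun n => by
    rw [windowMean_const_mul hhalf, windowMean_add hhalf, windowMean_const hhalf]
    exact mul_le_mul_of_nonneg_left (by linarith [windowMean_id_le hhalf p T₀ hp n]) (by positivity)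
  have hbound : ∀ n, |windowMean half p T₀ n h| ≤ M := fun n => by
    rw [abs_le]
    constructor
    · have := windowMean_mono hhalf p T₀ n (f := fun T => (-1) * h T) fun T =>
        (by linarith [neg_le_abs (h T)] : (-1) * h T ≤ |h T|).trans (habs T)
      rw [windowMean_const_mul hhalf] at this
      linarith [hlin n]
    · exact (windowMean_mono hhalf p T₀ n fun T => (le_abs_self _).trans (habs T)).trans (hlin n)
  have havg : ∀ n, 0 < n →
      averageSwaps half p T₀ n = c + (h T₀ - windowMean half p T₀ n h) / n := fun n hn => by
    have hn' : (n : ℝ) ≠ 0 := by positivity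
    have e : ∀ t, expectedSwaps half p T₀ t = windowMean half p T₀ t
        (fun T => c + (h T - step half (1 - (p : ℝ)) h T)) := fun t => by
      rw [← funext hc]; rfl
    rw [averageSwaps]
    simp only [e]
    rw [sum_windowMean_sub_step hhalf]
    field_simp
  have hzero : Tendsto (fun n : ℕ => (h T₀ - windowMean half p T₀ n h) / (n : ℝ)) atTop (𝓝 0) := by
    refine squeeze_zero_norm (fun n => ?_)
      (tendsto_const_div_atTop_nhds_zero_nat (|h T₀| + M))
    rw [norm_div, Real.norm_natCast, Real.norm_eq_abs]
    gcongr
    exact (abs_sub _ _).trans (add_le_add_right (hbound n) _)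
  have := hzero.const_add c
  rw [add_zero] at this
  refine this.congr' ?_
  filter_upwards [eventually_gt_atTop 0] with n hn using (havg n hn).symm

/-! ### Upper bound of order `1/√p` -/

theorem IsSpeedupFactor.nonneg {half : ℕ → ℕ} {p : I} {θ : ℝ} (h : IsSpeedupFactor half p θ) :
    0 ≤ θ := by
  refine ge_of_tendsto' (h 0) fun n => div_nonneg (Finset.sum_nonneg fun t _ => ?_) n.cast_nonneg
  refine tsum_nonneg fun T => mul_nonneg ENNReal.toReal_nonneg ?_
  rw [speedup_eq]
  exact mul_nonneg (pow_nonneg (sub_nonneg.2 p.2.2) T) T.cast_nonneg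

/-- The downward drift of `T` is at least `(1 - p)^T · pT(T - 1)/2 - 1` for `T ≥ 1`; this quadratic
gain dominates the linear term `√p · T` up to a constant. -/
theorem speedup_le_drift {half : ℕ → ℕ} (hhalf : IsHalving half) {p : ℝ} (h0 : 0 < p) (h1 : p ≤ 1)
    (T : ℕ) :
    (1 - p) ^ T * T ≤ 3 / √p
      + ((√p)⁻¹ * T - step half (1 - p) (fun S => (√p)⁻¹ * (S : ℝ)) T) := by
  obtain ⟨r, hr⟩ : ∃ r, r = √p := ⟨_, rfl⟩
  have hr0 : 0 < r := by rw [hr]; exact Real.sqrt_pos.2 h0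
  have hr2 : p = r ^ 2 := by rw [hr, Real.sq_sqrt h0.le]
  have hr1 : r ≤ 1 := by nlinarith
  rw [← hr]
  have e : step half (1 - p) (fun S => r⁻¹ * (S : ℝ)) T
      = r⁻¹ * step half (1 - p) (fun S => (S : ℝ)) T := by
    simp only [step]; ring
  have hid := step_id_le hhalf h0.le h1 T
  have hB := pow_mul_one_add_le_one h0.le h1 T
  have hy0 : 0 ≤ (1 - p) ^ T := pow_nonneg (by linarith) T
  have hy1 : (1 - p) ^ T ≤ 1 := pow_le_one₀ (by linarith) (by linarith)
  have hT : (0 : ℝ) ≤ T := T.cast_nonneg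
  rcases Nat.eq_zero_or_pos T with rfl | hTpos
  · simp [step, ← sub_nonneg]
    field_simp
    norm_num
  have hT1 : (1 : ℝ) ≤ T := by exact_mod_cast hTpos
  rw [e]
  set y := (1 - p) ^ T
  set x : ℝ := (T : ℝ)
  have hd : y * p * x * ((x - 1) / 2) ≤ (1 - y) * ((x - 1) / 2) :=
    mul_le_mul_of_nonneg_right (by linarith) (by linarith)
  have hq : y * (r * x) ≤ 2 + y * p * x * ((x - 1) / 2) := by
    -- A quadratic in `r * x` of negative discriminant, as `r ≤ 1`; the last term comes from the
    -- `-1` in `x * (x - 1)`.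
    have : r * x ≤ 2 + (r * x) ^ 2 / 2 - r * (r * x) / 2 := by
      nlinarith [sq_nonneg (r * x - 3 / 2), mul_nonneg hr0.le hT]
    have h3 := mul_le_mul_of_nonneg_left this hy0
    rw [hr2]
    nlinarith
  have hmain : r * (y * x) ≤ 3 + (x - step half (1 - p) (fun S => (S : ℝ)) T) := by linarith
  have : y * x ≤ r⁻¹ * (3 + (x - step half (1 - p) (fun S => (S : ℝ)) T)) := by
    rw [inv_mul_eq_div, le_div_iff₀ hr0]; linarith
  calc y * x ≤ _ := this
    _ = _ := by ring

theorem IsSpeedupFactor.le {half : ℕ → ℕ} (hhalf : IsHalving half) {p : I} (hp : 0 < p) {θ : ℝ}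
    (h : IsSpeedupFactor half p θ) : θ ≤ 3 / √(p : ℝ) := by
  refine le_of_tendsto (h 0) ?_
  filter_upwards [eventually_gt_atTop 0] with n hn
  have hn' : (0 : ℝ) < n := by exact_mod_cast hn
  rw [averageSwaps, div_le_iff₀ hn']
  have hle : ∀ t, expectedSwaps half p 0 t ≤ windowMean half p 0 t (fun T => 3 / √(p : ℝ)
      + ((√(p : ℝ))⁻¹ * T - step half (1 - (p : ℝ)) (fun S => (√(p : ℝ))⁻¹ * (S : ℝ)) T)) :=
    fun t => windowMean_mono hhalf p 0 t fun T => by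
      rw [speedup_eq]; exact speedup_le_drift hhalf hp p.2.2 T
  refine (Finset.sum_le_sum fun t _ => hle t).trans ?_
  -- Starting at window 0 kills the initial boundary term; the final one has a favourable sign.
  rw [sum_windowMean_sub_step hhalf p 0 (fun T => (√(p : ℝ))⁻¹ * (T : ℝ))]
  have : 0 ≤ windowMean half p 0 n fun T => (√(p : ℝ))⁻¹ * (T : ℝ) :=
    tsum_nonneg fun T => mul_nonneg ENNReal.toReal_nonneg (by positivity)
  push_cast
  linarith

/-! ### The maximal speed-up factor -/

/-- At `T = ⌊1/(2p)⌋`, `pT` lies in `[1/4, 1/2]`, and Bernoulli gives `(1 - p)^T ≥ 1/2`. -/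
theorem le_speedupMax {p : I} (hp : 0 < p) (hp4 : (p : ℝ) ≤ 1 / 4) :
    1 / (8 * (p : ℝ)) ≤ speedupMax p := by
  have h0 : 0 < (p : ℝ) := hp
  have hbdd : BddAbove (Set.range fun T => speedup p T) :=
    ⟨1 / p, by rintro _ ⟨T, rfl⟩; simp only [speedup_eq]; exact pow_mul_le_inv h0 p.2.2 T⟩
  refine le_trans ?_ (le_ciSup hbdd ⌊1 / (2 * (p : ℝ))⌋₊)
  set T := ⌊1 / (2 * (p : ℝ))⌋₊
  have hT : (T : ℝ) ≤ 1 / (2 * p) := Nat.floor_le (by positivity)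
  have hT' : 1 / (2 * (p : ℝ)) < T + 1 := Nat.lt_floor_add_one _
  have hB := one_add_mul_le_pow (a := -(p : ℝ)) (by linarith) T
  rw [← sub_eq_add_neg] at hB
  have hpT : p * (T : ℝ) ≤ 1 / 2 := by
    rw [le_div_iff₀ (by positivity)] at hT; linarith
  have hpT' : 1 / 4 ≤ p * (T : ℝ) := by
    rw [div_lt_iff₀ (by positivity)] at hT'; nlinarith
  rw [speedup_eq, div_le_iff₀ (by positivity)]
  nlinarith

theorem tendsto_speedupMax : Tendsto speedupMax (𝓝[>] (0 : I)) atTop := by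
  have hcoe : Tendsto (fun p : I => (p : ℝ)) (𝓝[>] 0) (𝓝[>] 0) :=
    tendsto_nhdsWithin_iff.2 ⟨(continuous_subtype_val.tendsto' 0 0 rfl).mono_left inf_le_left,
      eventually_mem_nhdsWithin⟩
  have hev : ∀ᶠ p : I in 𝓝[>] 0, (p : ℝ) ≤ 1 / 4 :=
    hcoe.eventually (eventually_nhdsWithin_of_eventually_nhds (eventually_le_nhds (by norm_num)))
  have hlim : Tendsto (fun p : I => 1 / (8 * (p : ℝ))) (𝓝[>] 0) atTop := by
    refine ((tendsto_inv_nhdsGT_zero.comp hcoe).const_mul_atTop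
      (by norm_num : (0 : ℝ) < 1 / 8)).congr fun p => ?_
    simp only [Function.comp]
    field_simp
  refine tendsto_atTop_mono' _ ?_ hlim
  filter_upwards [hev, eventually_mem_nhdsWithin] with p hp4 hp using le_speedupMax hp hp4

end Gkan

theorem theorem5 (half : ℕ → ℕ) (hhalf : Gkan.IsHalving half) :
    ∃ θ : I → ℝ,
      (∀ p : I, 0 < p → p < 1 → Gkan.IsSpeedupFactor half p (θ p)) ∧
      ∀ ε : ℝ, 0 < ε →
        θ =o[𝓝[>] (0 : I)] fun p => Gkan.speedupMax p ^ (1 / 2 + ε) := by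
  have hex : ∀ p : I, ∃ θ : ℝ, 0 < p → Gkan.IsSpeedupFactor half p θ := fun p => by
    by_cases hp : 0 < p
    · obtain ⟨θ, hθ⟩ := Gkan.exists_isSpeedupFactor hhalf hp
      exact ⟨θ, fun _ => hθ⟩
    -- Arbitrary value at `p = 0`, invisible to the filter `𝓝[>] 0`.
    · exact ⟨0, fun h => absurd h hp⟩
  choose θ hθ using hex
  refine ⟨θ, fun p hp _ => hθ p hp, fun ε hε => ?_⟩
  have hO : θ =O[𝓝[>] (0 : I)] fun p => Gkan.speedupMax p ^ (1 / 2 : ℝ) := by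
    refine IsBigO.of_bound 9 ?_
    have hev : ∀ᶠ p : I in 𝓝[>] 0, (p : ℝ) ≤ 1 / 4 :=
      eventually_nhdsWithin_of_eventually_nhds
        ((continuous_subtype_val.tendsto' (0 : I) (0 : ℝ) rfl).eventually
          (eventually_le_nhds (by norm_num)))
    filter_upwards [hev, eventually_mem_nhdsWithin] with p hp4 hp
    have h0 : 0 < (p : ℝ) := hp
    have hs : 0 < √(p : ℝ) := Real.sqrt_pos.2 h0
    rw [← Real.sqrt_eq_rpow, Real.norm_of_nonneg (hθ p hp).nonneg,
      Real.norm_of_nonneg (Real.sqrt_nonneg _)]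
    refine ((hθ p hp).le hhalf hp).trans ?_
    -- Weakening `1/(8p)` to `1/(9p)` gives a rational square root, hence the constant 9.
    have h3 : 1 / (3 * √(p : ℝ)) ≤ √(Gkan.speedupMax p) := by
      refine Real.le_sqrt_of_sq_le (le_trans ?_ (Gkan.le_speedupMax hp hp4))
      rw [div_pow, mul_pow, Real.sq_sqrt h0.le]
      gcongr <;> norm_num
    calc 3 / √(p : ℝ) = 9 * (1 / (3 * √(p : ℝ))) := by field_simp; norm_num
      _ ≤ _ := by gcongr
  have ho : (fun x : ℝ => x ^ (1 / 2 : ℝ)) =o[atTop] fun x => x ^ (1 / 2 + ε) := by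
    refine (isLittleO_iff_tendsto' ?_).2 ((tendsto_rpow_neg_atTop hε).congr' ?_)
    · filter_upwards [eventually_gt_atTop 0] with x hx h
      exact absurd h (Real.rpow_pos_of_pos hx _).ne'
    · filter_upwards [eventually_gt_atTop 0] with x hx
      rw [← Real.rpow_sub hx]
      congr 1
      ring
  exact hO.trans_isLittleO (ho.comp_tendsto Gkan.tendsto_speedupMax)
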